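/- **Setting.** Let $\mathcal S,\mathcal A$ be finite sets (states, actions), $\phi:\mathcal S\times\mathcal A\to\mathbb R^d$ a feature mapping and $n\in\mathbb N$. A linear contextual bandit instance $\mathcal Q=(\rho,\{(s_i,a_i)\}_{i=1}^n,\theta^\star,R)$ consists of a test distribution $\rho$ on $\mathcal S$, fixed covariates $(s_i,a_i)\in\mathcal S\times\mathcal A$ for which $\Sigma_{\mathcal D}=\frac1n\sum_{i=1}^n\phi(s_i,a_i)\phi(s_i,a_i)^\top$ is invertible, a vector $\theta^\star\in\mathbb R^d$, and reward distributions $R(s,a)$ on $\mathbb R$ with mean $r(s,a)=\phi(s,a)^\top\theta^\star$ that are $1$-subgaussian: $\mathbb P[|X-\mathbb EX|\ge t]\le 2e^{-t^2/2}$ for all $t\ge0$ when $X\sim R(s,a)$. The value of a policy $\pi:\mathcal S\to\mathcal A$ is $V_{\mathcal Q}(\pi)=\mathbb E_{s\sim\rho}[r(s,\pi(s))]$, an optimal policy is any $\pi^\star$ with $\pi^\star(s)\in\arg\max_a r(s,a)$ for every $s$, and $V^\star_{\mathcal Q}=V_{\mathcal Q}(\pi^\star)$. For $q\ge1$ and $\Lambda>0$,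 let $\mathsf{CB}_q(\Lambda)$ be the set of all instances with $$\bigl\|\Sigma_{\mathcal D}^{-1/2}\,\mathbb E_{s\sim\rho}[\phi(s,\pi^\star(s))]\bigr\|_q\le\Lambda$$ for every optimal policy $\pi^\star$. The rewards $r_i\sim R(s_i,a_i)$, $i=1,\dots,n$, are independent. A learning rule $\hat\pi$ is a map, measurable in the rewards, that takes $\rho$ and the dataset $\{(s_i,a_i,r_i)\}_{i=1}^n$ to a deterministic policy $\mathcal S\to\mathcal A$. **Proposition.** There is a universal constant $c>0$ such that for every integer $d\ge2$ there exist finite sets $\mathcal S,\mathcal A$ and a feature mapping $\phi:\mathcal S\times\mathcal A\to\mathbb R^d$ with the following property. For all $q\in(1,2]$, with $p$ given by $1/p+1/q=1$, all real $\Lambda\ge\sqrt{12}$ and all $n\in\mathbb N$ with $n\ge d^{2/q}\Lambda^2$, $$\inf_{\hat\pi}\ \sup_{\mathcal Q\in\mathsf{CB}_q(\Lambda)}\ \mathbb E\bigl[V^\star_{\mathcal Q}-V_{\mathcal Q}(\hat\pi)\bigr]\ \ge\ c\cdot d^{1/p}\sqrt{\frac1n}\cdot\Lambda ,$$ where the infimum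 is over all learning rules and $V_{\mathcal Q}(\hat\pi)$ is the value of the policy that $\hat\pi$ outputs. -/

import Mathlib

open MeasureTheory
open scoped BigOperators ENNReal MatrixOrder

noncomputable section

namespace OfflineCB

/-- A probability measure on `ℝ` is `1`-subgaussian: it has a mean, and
`P[|X - E X| ≥ t] ≤ 2 exp(-t² / 2)` for all `t ≥ 0`. -/
def IsOneSubgaussian (P : ProbabilityMeasure ℝ) : Prop :=
  Integrable (fun x : ℝ => x) (P : Measure ℝ) ∧
    ∀ t : ℝ, 0 ≤ t →
      (P : Measure ℝ).real {x : ℝ | t ≤ |x - ∫ y, y ∂(P : Measure ℝ)|}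
        ≤ 2 * Real.exp (-t ^ 2 / 2)

/-- The data of a contextual bandit instance with finite state space `S`, finite action space `A`,
parameter dimension `d` and sample size `n`: a test distribution `ρ` on `S`, the fixed design
`(s_i, a_i)`, the parameter vector `θ` and the reward distributions `R(s, a)`. -/
structure Instance (S A : Type) [Fintype S] (d n : ℕ) where
  ρ : stdSimplex ℝ S
  design : Fin n → S × A
  θ : Fin d → ℝ
  R : S → A → ProbabilityMeasure ℝ

/-- A learning rule: it sees the test distribution, the design and the observed rewards, and it
returns a deterministic policy. It is measurable as a function of the rewards. -/
structure LearningRule (S A : Type) [Fintype S] (n : ℕ) where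
  toFun : stdSimplex ℝ S → (Fin n → S × A) → (Fin n → ℝ) → (S → A)
  measurable' : ∀ (ρ : stdSimplex ℝ S) (x : Fin n → S × A) (π : S → A),
    MeasurableSet {r : Fin n → ℝ | toFun ρ x r = π}

variable {S A : Type} [Fintype S] {d n : ℕ}

/-- The sample covariance matrix `(1/n) ∑ᵢ φ(sᵢ, aᵢ) φ(sᵢ, aᵢ)ᵀ`. -/
def sampleCov (φ : S × A → Fin d → ℝ) (x : Fin n → S × A) : Matrix (Fin d) (Fin d) ℝ :=
  (n : ℝ)⁻¹ • ∑ i, Matrix.vecMulVec (φ (x i)) (φ (x i))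

/-- The `ℓ_q` norm on `ℝ^d`, for real `q ≥ 1`. -/
def lqNorm (q : ℝ) (v : Fin d → ℝ) : ℝ :=
  (∑ j, |v j| ^ q) ^ (1 / q)

/-- The mean feature vector `E_{s ∼ ρ} [φ(s, π(s))]`. -/
def meanFeature (φ : S × A → Fin d → ℝ) (ρ : stdSimplex ℝ S) (π : S → A) : Fin d → ℝ :=
  ∑ s, (ρ : S → ℝ) s • φ (s, π s)

namespace Instance

/-- The mean reward `r(s, a) = E[R(s, a)]`. -/
def meanReward (Q : Instance S A d n) (s : S) (a : A) : ℝ :=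
  ∫ y, y ∂(Q.R s a : Measure ℝ)

/-- The value `V(π) = E_{s ∼ ρ} [r(s, π(s))]`. -/
def value (Q : Instance S A d n) (π : S → A) : ℝ :=
  ∑ s, (Q.ρ : S → ℝ) s * Q.meanReward s (π s)

/-- The optimal value `V⋆ = E_{s ∼ ρ} [max_a r(s, a)]`. -/
def optValue (Q : Instance S A d n) : ℝ :=
  ∑ s, (Q.ρ : S → ℝ) s * ⨆ a, Q.meanReward s a

/-- `π` is an optimal policy: `π(s)` maximizes the mean reward in every state `s`. -/
def IsOptimal (Q : Instance S A d n) (π : S → A) : Prop :=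
  ∀ s a, Q.meanReward s a ≤ Q.meanReward s (π s)

/-- The law of the reward vector: independent rewards `r_i ∼ R(s_i, a_i)`. -/
def rewardLaw (Q : Instance S A d n) : Measure (Fin n → ℝ) :=
  Measure.pi fun i => (Q.R (Q.design i).1 (Q.design i).2 : Measure ℝ)

/-- The expected suboptimality `E[V⋆ - V(π̂)]` of a learning rule; `V⋆ - V(π̂)` is nonnegative,
so the expectation is taken in `[0, ∞]`. -/
def expectedSubopt (Q : Instance S A d n) (L : LearningRule S A n) : ℝ≥0∞ :=
  ∫⁻ r, ENNReal.ofReal (Q.optValue - Q.value (L.toFun Q.ρ Q.design r)) ∂Q.rewardLaw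

end Instance

/-- The class `CB_q(Λ)` for the feature mapping `φ` and sample size `n`: the reward distributions
are `1`-subgaussian with mean reward `φ(s, a)ᵀ θ`, the sample covariance matrix is invertible, and
`‖Σ^{-1/2} E_{s ∼ ρ} [φ(s, π⋆(s))]‖_q ≤ Λ`. When the optimal policy is not unique, the bound is
required of every optimal policy; this is the smallest reading of the class. -/
def CB (φ : S × A → Fin d → ℝ) (n : ℕ) (q Λ : ℝ) : Set (Instance S A d n) :=
  {Q | (∀ s a, IsOneSubgaussian (Q.R s a)) ∧
    (∀ s a, Q.meanReward s a = φ (s, a) ⬝ᵥ Q.θ) ∧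
    IsUnit (sampleCov φ Q.design) ∧
    ∀ π : S → A, Q.IsOptimal π →
      lqNorm q (Matrix.mulVec (CFC.sqrt (sampleCov φ Q.design))⁻¹ (meanFeature φ Q.ρ π)) ≤ Λ}

/-- The minimax expected suboptimality `inf_π̂ sup_{Q ∈ CB_q(Λ)} E[V⋆_Q - V_Q(π̂)]`. -/
def minimaxSubopt (φ : S × A → Fin d → ℝ) (n : ℕ) (q Λ : ℝ) : ℝ≥0∞ :=
  ⨅ L : LearningRule S A n, ⨆ Q ∈ CB φ n q Λ, Q.expectedSubopt L

end OfflineCB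

end

/-!
The lower bound is an application of Assouad's method to a family of `2 ^ d` instances that share
the test distribution and the design.

The states are `none` and `some j` for `j < d`, and the actions are the two signs. The feature of
the sign `±` in state `some j` is `±e_j`, while every feature in state `none` vanishes. The
parameter `θ` ranges over the vertices of the cube `{-1/4, 1/4}^d`, so that in state `some j` the
optimal action is the sign of `θ_j`, and the other one loses `1/2`. The design visits each
direction `e_j` exactly once and spends the other samples in state `none`, where they carry no
information. The rewards live on `{-1/2, 1/2}`: deviations from the mean are then less than `1`,
which makes them `1`-subgaussian, and the laws for two means in `[-1/4, 1/4]` differ in density by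
a factor of at most `3`. Flipping one coordinate of `θ` therefore changes the law of the data by a
factor of at most `3` (`rewardLaw_flip_le`), and no rule can identify the sign of `θ_j` with small
error probability under both vertices (`card_mul_le_of_flip_le`).

The sample covariance is `n⁻¹` times the identity, so if `ρ` gives mass `α` to each of the states
`some j`, the vector `Σ^{-1/2} E φ(s, π(s))` has all its entries equal to `±√n α`, whatever the
policy `π`. The choice `α = Λ / (d^{1/q} √n)` gives it `ℓ_q` norm `Λ`, and `d α ≤ 1` because
`n ≥ d^{2/q} Λ²` and `q ≤ 2`. The resulting lower bound is of order `d α = d^{1/p} Λ / √n`.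
-/

noncomputable section

namespace OfflineCB

/-! ### Product measures and Assouad's method -/

/-- If two families of measures agree except at one index, where they differ by a factor of at
most `c`, then their products differ by a factor of at most `c`. -/
theorem pi_le_smul_pi {ι : Type*} [Fintype ι] {X : ι → Type*} [∀ i, MeasurableSpace (X i)]
    (μ ν : ∀ i, Measure (X i)) [∀ i, SigmaFinite (μ i)] (i₀ : ι) (c : ℝ≥0∞) (hc : c ≠ 0)
    (hc' : c ≠ ∞) (hne : ∀ i, i ≠ i₀ → μ i = ν i) (h : μ i₀ ≤ c • ν i₀) :
    Measure.pi μ ≤ c • Measure.pi ν := by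
  classical
  -- `OuterMeasure.pi` is the largest outer measure with given bounds on boxes, so it is enough to
  -- compare the two sides on boxes.
  have key : (c⁻¹ • Measure.pi μ).toOuterMeasure ≤
      OuterMeasure.pi fun i => (ν i).toOuterMeasure := by
    rw [OuterMeasure.le_pi]
    intro s _
    have h₁ : μ i₀ (s i₀) ≤ c * ν i₀ (s i₀) := h (s i₀)
    have h₂ : ∏ i ∈ Finset.univ.erase i₀, μ i (s i) = ∏ i ∈ Finset.univ.erase i₀, ν i (s i) :=
      Finset.prod_congr rfl fun i hi => by rw [hne i (Finset.ne_of_mem_erase hi)]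
    change c⁻¹ * Measure.pi μ (Set.univ.pi s) ≤ ∏ i, ν i (s i)
    rw [Measure.pi_pi, ← Finset.mul_prod_erase _ _ (Finset.mem_univ i₀),
      ← Finset.mul_prod_erase _ (fun i => ν i (s i)) (Finset.mem_univ i₀), h₂, ← mul_assoc]
    gcongr
    calc c⁻¹ * μ i₀ (s i₀) ≤ c⁻¹ * (c * ν i₀ (s i₀)) := by gcongr
      _ = ν i₀ (s i₀) := by rw [← mul_assoc, ENNReal.inv_mul_cancel hc hc', one_mul]
  intro s
  have h₁ : c⁻¹ * Measure.pi μ s ≤ Measure.pi ν s := by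
    rw [Measure.pi_def ν]
    exact (key s).trans (le_toMeasure_apply _ _ _)
  calc Measure.pi μ s = c * (c⁻¹ * Measure.pi μ s) := by
        rw [← mul_assoc, ENNReal.mul_inv_cancel hc hc', one_mul]
    _ ≤ c * Measure.pi ν s := by gcongr

/-- The sign vector `σ` with its `j`-th entry flipped. -/
def flip {d : ℕ} (j : Fin d) (σ : Fin d → Bool) : Fin d → Bool :=
  Function.update σ j (!σ j)

theorem flip_involutive {d : ℕ} (j : Fin d) : Function.Involutive (flip j) := by
  intro σ
  simp [flip]

/-- Assouad's method: if flipping one sign of `σ` changes `P σ` by a factor of at most `K`, then an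
estimate `Z` of `σ` has total weighted error probability of order at least `d c` at some `σ`. -/
theorem card_mul_le_of_flip_le {d : ℕ} {Ω : Type*} [MeasurableSpace Ω]
    (P : (Fin d → Bool) → Measure Ω) [∀ σ, IsProbabilityMeasure (P σ)] (K : ℝ≥0∞) (hK : 1 ≤ K)
    (hP : ∀ σ j, P (flip j σ) ≤ K • P σ) (Z : Ω → Fin d → Bool) (c M : ℝ≥0∞)
    (hM : ∀ σ, ∑ j, c * P σ {ω | Z ω j ≠ σ j} ≤ M) :
    (d : ℝ≥0∞) * c ≤ 2 * K * M := by
  have hpair : ∀ (j : Fin d) (σ : Fin d → Bool),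
      1 ≤ K * (P σ {ω | Z ω j ≠ σ j} + P (flip j σ) {ω | Z ω j ≠ flip j σ j}) := by
    intro j σ
    have hcompl : {ω | Z ω j ≠ flip j σ j} = {ω | Z ω j ≠ σ j}ᶜ := by
      ext ω
      simp only [flip, Function.update_self, Set.mem_ofPred_eq, Set.mem_compl_iff, not_not]
      cases Z ω j <;> cases σ j <;> simp
    rw [hcompl, mul_add]
    calc (1 : ℝ≥0∞) = P (flip j σ) ({ω | Z ω j ≠ σ j} ∪ {ω | Z ω j ≠ σ j}ᶜ) := by
          rw [Set.union_compl_self, measure_univ]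
      _ ≤ P (flip j σ) {ω | Z ω j ≠ σ j} + P (flip j σ) {ω | Z ω j ≠ σ j}ᶜ :=
          measure_union_le _ _
      _ ≤ K * P σ {ω | Z ω j ≠ σ j} + K * P (flip j σ) {ω | Z ω j ≠ σ j}ᶜ :=
          add_le_add (hP σ j _) (le_mul_of_one_le_left zero_le hK)
  set N : ℝ≥0∞ := (Fintype.card (Fin d → Bool) : ℝ≥0∞) with hN
  have hsum : ∀ j : Fin d, N ≤ 2 * K * ∑ σ, P σ {ω | Z ω j ≠ σ j} := by
    intro j
    have hflip : ∑ σ, P (flip j σ) {ω | Z ω j ≠ flip j σ j} = ∑ σ, P σ {ω | Z ω j ≠ σ j} :=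
      (flip_involutive j).bijective.sum_comp fun σ => P σ {ω | Z ω j ≠ σ j}
    calc N = ∑ _σ : Fin d → Bool, (1 : ℝ≥0∞) := by simp [hN]
      _ ≤ ∑ σ, K * (P σ {ω | Z ω j ≠ σ j} + P (flip j σ) {ω | Z ω j ≠ flip j σ j}) :=
          Finset.sum_le_sum fun σ _ => hpair j σ
      _ = 2 * K * ∑ σ, P σ {ω | Z ω j ≠ σ j} := by
          rw [← Finset.mul_sum, Finset.sum_add_distrib, hflip]; ring
  have hmain : N * ((d : ℝ≥0∞) * c) ≤ N * (2 * K * M) := by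
    calc N * ((d : ℝ≥0∞) * c) = ∑ _j : Fin d, c * N := by simp; ring
      _ ≤ ∑ j, c * (2 * K * ∑ σ, P σ {ω | Z ω j ≠ σ j}) :=
          Finset.sum_le_sum fun j _ => by gcongr; exact hsum j
      _ = 2 * K * ∑ σ, ∑ j, c * P σ {ω | Z ω j ≠ σ j} := by
          rw [Finset.sum_comm, Finset.mul_sum]
          refine Finset.sum_congr rfl fun j _ => ?_
          rw [← Finset.mul_sum]; ring
      _ ≤ 2 * K * ∑ _σ : Fin d → Bool, M := by
          gcongr with σ; exact hM σ
      _ = N * (2 * K * M) := by simp [hN]; ring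
  have hN0 : N ≠ 0 := by simp [hN]
  have hNtop : N ≠ ∞ := by simp [hN]
  exact (ENNReal.mul_le_mul_iff_right hN0 hNtop).1 hmain

/-! ### Two-point reward distributions -/

/-- The measure on `{-1/2, 1/2}` with mean `m`; it is a probability measure when `|m| ≤ 1/2`. -/
def twoPointMeasure (m : ℝ) : Measure ℝ :=
  ENNReal.ofReal (1 / 2 + m) • Measure.dirac (1 / 2) +
    ENNReal.ofReal (1 / 2 - m) • Measure.dirac (-1 / 2)

theorem isProbabilityMeasure_twoPointMeasure {m : ℝ} (hm : |m| ≤ 1 / 4) :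
    IsProbabilityMeasure (twoPointMeasure m) := by
  obtain ⟨h₁, h₂⟩ := abs_le.1 hm
  constructor
  simp only [twoPointMeasure, Measure.add_apply, Measure.smul_apply, measure_univ, smul_eq_mul,
    mul_one]
  rw [← ENNReal.ofReal_add (by linarith) (by linarith)]
  norm_num

/-- The probability measure on `{-1/2, 1/2}` with mean `m`, for `|m| ≤ 1/4`. -/
def twoPoint (m : ℝ) (hm : |m| ≤ 1 / 4) : ProbabilityMeasure ℝ :=
  ⟨twoPointMeasure m, isProbabilityMeasure_twoPointMeasure hm⟩

theorem integrable_twoPointMeasure (m : ℝ) : Integrable (fun x : ℝ => x) (twoPointMeasure m) :=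
  ((integrable_dirac (by simp)).smul_measure ENNReal.ofReal_ne_top).add_measure
    ((integrable_dirac (by simp)).smul_measure ENNReal.ofReal_ne_top)

theorem integral_twoPoint {m : ℝ} (hm : |m| ≤ 1 / 4) :
    ∫ y, y ∂(twoPoint m hm : Measure ℝ) = m := by
  obtain ⟨h₁, h₂⟩ := abs_le.1 hm
  change ∫ y, y ∂twoPointMeasure m = m
  rw [twoPointMeasure, integral_add_measure
    ((integrable_dirac (by simp)).smul_measure ENNReal.ofReal_ne_top)
    ((integrable_dirac (by simp)).smul_measure ENNReal.ofReal_ne_top),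
    integral_smul_measure, integral_smul_measure, integral_dirac, integral_dirac,
    ENNReal.toReal_ofReal (by linarith), ENNReal.toReal_ofReal (by linarith)]
  simp only [smul_eq_mul]
  ring

/-- The deviation from the mean is less than `1` almost surely, and the subgaussian tail bound is
vacuous for `t ≤ 1`, since `2 exp (-1/2) ≥ 1`. -/
theorem isOneSubgaussian_twoPoint {m : ℝ} (hm : |m| ≤ 1 / 4) :
    IsOneSubgaussian (twoPoint m hm) := by
  obtain ⟨h₁, h₂⟩ := abs_le.1 hm
  refine ⟨integrable_twoPointMeasure m, fun t ht => ?_⟩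
  rw [integral_twoPoint]
  by_cases h : t ≤ 1
  · have h₃ : (1 : ℝ) ≤ 2 * Real.exp (-t ^ 2 / 2) := by
      have := Real.add_one_le_exp (-t ^ 2 / 2)
      nlinarith
    exact measureReal_le_one.trans h₃
  · have h₃ : (twoPoint m hm : Measure ℝ) {x : ℝ | t ≤ |x - m|} = 0 := by
      have hs : MeasurableSet {x : ℝ | t ≤ |x - m|} := by measurability
      have ha : (1 / 2 : ℝ) ∉ {x : ℝ | t ≤ |x - m|} := by
        simp only [Set.mem_ofPred_eq, not_le, abs_lt]
        constructor <;> linarith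
      have hb : (-1 / 2 : ℝ) ∉ {x : ℝ | t ≤ |x - m|} := by
        simp only [Set.mem_ofPred_eq, not_le, abs_lt]
        constructor <;> linarith
      change twoPointMeasure m _ = 0
      simp only [twoPointMeasure, Measure.add_apply, Measure.smul_apply,
        Measure.dirac_apply' _ hs, Set.indicator_of_notMem ha, Set.indicator_of_notMem hb]
      simp
    rw [measureReal_def, h₃, ENNReal.toReal_zero]
    positivity

theorem twoPoint_le_smul_twoPoint {m m' : ℝ} (hm : |m| ≤ 1 / 4) (hm' : |m'| ≤ 1 / 4) :
    (twoPoint m hm : Measure ℝ) ≤ (3 : ℝ≥0∞) • (twoPoint m' hm' : Measure ℝ) := by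
  obtain ⟨h₁, h₂⟩ := abs_le.1 hm
  obtain ⟨h₃, h₄⟩ := abs_le.1 hm'
  have h3 : (3 : ℝ≥0∞) = ENNReal.ofReal 3 := by simp
  intro s
  change twoPointMeasure m s ≤ 3 * twoPointMeasure m' s
  simp only [twoPointMeasure, Measure.add_apply, Measure.smul_apply, smul_eq_mul]
  rw [mul_add, ← mul_assoc, ← mul_assoc, h3, ← ENNReal.ofReal_mul (by norm_num),
    ← ENNReal.ofReal_mul (by norm_num)]
  gcongr <;> linarith

/-! ### The family of hard instances -/

/-- The sign `±1` encoded by a Boolean. -/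
def sgn (b : Bool) : ℝ := if b then 1 else -1

/-- The feature mapping: `±e_j` in state `some j` according to the action, and `0` in state
`none`. -/
def feature (d : ℕ) : Option (Fin d) × Bool → Fin d → ℝ
  | (some j, b) => Pi.single j (sgn b)
  | (none, _) => 0

/-- The vertex of the cube `{-1/4, 1/4}^d` with sign vector `σ`. -/
def cubeVertex {d : ℕ} (σ : Fin d → Bool) : Fin d → ℝ := fun j => sgn (σ j) / 4

theorem feature_some_dotProduct {d : ℕ} (σ : Fin d → Bool) (j : Fin d) (b : Bool) :
    feature d (some j, b) ⬝ᵥ cubeVertex σ = if b = σ j then 1 / 4 else -1 / 4 := by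
  simp only [feature, cubeVertex, single_dotProduct, sgn]
  cases b <;> cases σ j <;> norm_num

theorem feature_none_dotProduct {d : ℕ} (θ : Fin d → ℝ) (b : Bool) :
    feature d (none, b) ⬝ᵥ θ = 0 := by
  simp [feature]

theorem abs_feature_dotProduct_le {d : ℕ} (σ : Fin d → Bool) (x : Option (Fin d) × Bool) :
    |feature d x ⬝ᵥ cubeVertex σ| ≤ 1 / 4 := by
  obtain ⟨_ | j, b⟩ := x
  · simp [feature_none_dotProduct]
  · rw [feature_some_dotProduct]
    split_ifs <;> norm_num [abs_le]

/-- The design that visits each feature `e_j` once (at time `j`), and afterwards stays in the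
state with zero features. -/
def hardDesign (d n : ℕ) (i : Fin n) : Option (Fin d) × Bool :=
  (if h : (i : ℕ) < d then some ⟨i, h⟩ else none, true)

/-- The distribution that gives mass `α` to each state `some j` and the rest to `none`. -/
def hardDist (d : ℕ) (α : ℝ) (h₀ : 0 ≤ α) (h₁ : d * α ≤ 1) : stdSimplex ℝ (Option (Fin d)) :=
  ⟨fun s => s.elim (1 - d * α) fun _ => α, by
    constructor
    · rintro (_ | j)
      · simpa using h₁
      · exact h₀
    · simp [Fintype.sum_option]⟩

/-- The instance with parameter `cubeVertex σ` and two-point rewards. -/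
def hardInstance {d : ℕ} (n : ℕ) (ρ : stdSimplex ℝ (Option (Fin d))) (σ : Fin d → Bool) :
    Instance (Option (Fin d)) Bool d n where
  ρ := ρ
  design := hardDesign d n
  θ := cubeVertex σ
  R s a := twoPoint (feature d (s, a) ⬝ᵥ cubeVertex σ) (abs_feature_dotProduct_le σ (s, a))

theorem hardInstance_meanReward {d n : ℕ} (ρ : stdSimplex ℝ (Option (Fin d)))
    (σ : Fin d → Bool) (s : Option (Fin d)) (a : Bool) :
    (hardInstance n ρ σ).meanReward s a = feature d (s, a) ⬝ᵥ cubeVertex σ :=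
  integral_twoPoint (abs_feature_dotProduct_le σ (s, a))

instance isProbabilityMeasure_rewardLaw {S A : Type} [Fintype S] {d n : ℕ}
    (Q : Instance S A d n) : IsProbabilityMeasure Q.rewardLaw :=
  inferInstanceAs (IsProbabilityMeasure (Measure.pi _))

/-- Only the sample at time `j` depends on the sign `σ j`. -/
theorem rewardLaw_flip_le {d n : ℕ} (hdn : d ≤ n) (ρ : stdSimplex ℝ (Option (Fin d)))
    (σ : Fin d → Bool) (j : Fin d) :
    (hardInstance n ρ (flip j σ)).rewardLaw ≤ (3 : ℝ≥0∞) • (hardInstance n ρ σ).rewardLaw := by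
  refine pi_le_smul_pi _ _ (Fin.castLE hdn j) 3 (by simp) (by simp) (fun i hi => ?_)
    (twoPoint_le_smul_twoPoint (abs_feature_dotProduct_le _ _) (abs_feature_dotProduct_le _ _))
  have h : feature d (hardDesign d n i) ⬝ᵥ cubeVertex (flip j σ) =
      feature d (hardDesign d n i) ⬝ᵥ cubeVertex σ := by
    unfold hardDesign
    split_ifs with hid
    · rw [feature_some_dotProduct, feature_some_dotProduct, flip, Function.update_of_ne]
      rintro rfl
      exact hi rfl
    · rw [feature_none_dotProduct, feature_none_dotProduct]
  exact congrArg twoPointMeasure h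

/-! ### Membership in the class -/

theorem sampleCov_hardDesign {d n : ℕ} (hdn : d ≤ n) :
    sampleCov (feature d) (hardDesign d n) = (n : ℝ)⁻¹ • (1 : Matrix (Fin d) (Fin d) ℝ) := by
  obtain ⟨k, rfl⟩ := Nat.exists_eq_add_of_le hdn
  unfold sampleCov
  congr 1
  rw [Fin.sum_univ_add]
  have h₁ : ∀ i : Fin d, hardDesign d (d + k) (Fin.castAdd k i) = (some i, true) := by
    intro i
    simp [hardDesign]
  have h₂ : ∀ i : Fin k, hardDesign d (d + k) (Fin.natAdd d i) = (none, true) := by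
    intro i
    simp [hardDesign]
  simp only [h₁, h₂, feature, sgn, Matrix.vecMulVec_zero, Finset.sum_const_zero, add_zero, if_true]
  ext a b
  simp [Matrix.sum_apply, Matrix.vecMulVec_apply, Pi.single_apply, Matrix.one_apply]

theorem inv_sqrt_sampleCov_hardDesign {d n : ℕ} (hdn : d ≤ n) (hn : 0 < n) :
    (CFC.sqrt (sampleCov (feature d) (hardDesign d n)))⁻¹ =
      Real.sqrt n • (1 : Matrix (Fin d) (Fin d) ℝ) := by
  have hn' : (0 : ℝ) < Real.sqrt n := Real.sqrt_pos.2 (by exact_mod_cast hn)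
  have h : CFC.sqrt (sampleCov (feature d) (hardDesign d n)) =
      (Real.sqrt n)⁻¹ • (1 : Matrix (Fin d) (Fin d) ℝ) := by
    rw [sampleCov_hardDesign hdn]
    refine CFC.sqrt_unique ?_ ?_
    · rw [smul_mul_smul_comm, mul_one, ← mul_inv, Real.mul_self_sqrt (Nat.cast_nonneg n)]
    · exact Matrix.nonneg_iff_posSemidef.2 (Matrix.PosSemidef.one.smul (by positivity))
  rw [h]
  refine Matrix.inv_eq_left_inv ?_
  rw [smul_mul_smul_comm, mul_one, mul_inv_cancel₀ hn'.ne', one_smul]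

theorem meanFeature_hardDist {d : ℕ} {α : ℝ} (h₀ : 0 ≤ α) (h₁ : d * α ≤ 1)
    (π : Option (Fin d) → Bool) (j : Fin d) :
    meanFeature (feature d) (hardDist d α h₀ h₁) π j = α * sgn (π (some j)) := by
  have hρ : ∀ i : Fin d, (hardDist d α h₀ h₁ : Option (Fin d) → ℝ) (some i) = α := fun _ => rfl
  simp [meanFeature, Fintype.sum_option, hρ, feature, Finset.sum_apply, Pi.single_apply]

theorem abs_sgn (b : Bool) : |sgn b| = 1 := by
  cases b <;> simp [sgn]

theorem lqNorm_of_abs_eq {d : ℕ} {q β : ℝ} (hq : 0 < q) (hβ : 0 ≤ β) {v : Fin d → ℝ}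
    (hv : ∀ j, |v j| = β) : lqNorm q v = (d : ℝ) ^ (1 / q) * β := by
  simp only [lqNorm, hv, Finset.sum_const, Finset.card_univ, Fintype.card_fin, nsmul_eq_mul]
  rw [Real.mul_rpow (by positivity) (by positivity), ← Real.rpow_mul hβ,
    mul_one_div_cancel hq.ne', Real.rpow_one]

theorem hardInstance_mem_CB {d n : ℕ} (hdn : d ≤ n) (hn : 0 < n) {α q Λ : ℝ} (hq : 0 < q)
    (h₀ : 0 ≤ α) (h₁ : d * α ≤ 1) (hΛ : (d : ℝ) ^ (1 / q) * (Real.sqrt n * α) ≤ Λ)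
    (σ : Fin d → Bool) :
    hardInstance n (hardDist d α h₀ h₁) σ ∈ CB (feature d) n q Λ := by
  refine ⟨fun s a => isOneSubgaussian_twoPoint (abs_feature_dotProduct_le σ (s, a)),
     fun s a => hardInstance_meanReward _ _ _ _,
    ?_, fun π _ => ?_⟩
  · change IsUnit (sampleCov (feature d) (hardDesign d n))
    rw [sampleCov_hardDesign hdn]
    have hn' : ((n : ℝ)⁻¹) ≠ 0 := by positivity
    exact isUnit_one.smul (Units.mk0 _ hn')
  · change lqNorm q (Matrix.mulVec (CFC.sqrt (sampleCov (feature d) (hardDesign d n)))⁻¹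
      (meanFeature (feature d) (hardDist d α h₀ h₁) π)) ≤ Λ
    rw [inv_sqrt_sampleCov_hardDesign hdn hn, Matrix.smul_mulVec, Matrix.one_mulVec,
      lqNorm_of_abs_eq (β := Real.sqrt n * α) hq (by positivity)]
    · exact hΛ
    · intro j
      rw [Pi.smul_apply, meanFeature_hardDist, smul_eq_mul, abs_mul, abs_mul, abs_sgn, mul_one,
        abs_of_nonneg h₀, abs_of_nonneg (Real.sqrt_nonneg _)]

/-! ### The lower bound -/

/-- Each state `some j` in which the policy misses the sign `σ j` costs `α / 2`. -/
theorem hardInstance_subopt {d n : ℕ} {α : ℝ} (h₀ : 0 ≤ α) (h₁ : d * α ≤ 1) (σ : Fin d → Bool)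
    (π : Option (Fin d) → Bool) :
    (hardInstance n (hardDist d α h₀ h₁) σ).optValue -
        (hardInstance n (hardDist d α h₀ h₁) σ).value π =
      ∑ j, if π (some j) ≠ σ j then α / 2 else 0 := by
  have hsup : ∀ j : Fin d, (⨆ a : Bool, if a = σ j then (1 / 4 : ℝ) else -1 / 4) = 1 / 4 := by
    intro j
    refine le_antisymm (ciSup_le fun a => by split_ifs <;> norm_num) ?_
    exact (by simp : (1 / 4 : ℝ) ≤ if σ j = σ j then (1 / 4 : ℝ) else -1 / 4).trans
      (le_ciSup (Set.finite_range fun a : Bool => if a = σ j then (1 / 4 : ℝ) else -1 / 4).bddAbove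
        (σ j))
  have hρ : ∀ j : Fin d,
      (((hardInstance n (hardDist d α h₀ h₁) σ).ρ : Option (Fin d) → ℝ) (some j)) = α :=
    fun _ => rfl
  simp only [Instance.optValue, Instance.value, Fintype.sum_option, hardInstance_meanReward,
    feature_none_dotProduct, feature_some_dotProduct, hsup, ciSup_const, mul_zero, zero_add, hρ]
  rw [← Finset.sum_sub_distrib]
  refine Finset.sum_congr rfl fun j _ => ?_
  by_cases h : π (some j) = σ j
  · simp [h]
  · simp only [h, if_false, ne_eq, not_false_eq_true, if_true]
    ring

theorem LearningRule.measurableSet_preimage {S A : Type} [Fintype S] [Fintype A] {n : ℕ}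
    (L : LearningRule S A n) (ρ : stdSimplex ℝ S) (x : Fin n → S × A) (T : Set (S → A)) :
    MeasurableSet {r : Fin n → ℝ | L.toFun ρ x r ∈ T} := by
  have h : {r : Fin n → ℝ | L.toFun ρ x r ∈ T} = ⋃ π ∈ T, {r | L.toFun ρ x r = π} := by
    ext r
    simp
  rw [h]
  exact T.toFinite.measurableSet_biUnion fun π _ => L.measurable' ρ x π

theorem hardInstance_expectedSubopt {d n : ℕ} {α : ℝ} (h₀ : 0 ≤ α) (h₁ : d * α ≤ 1)
    (σ : Fin d → Bool) (L : LearningRule (Option (Fin d)) Bool n) :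
    (hardInstance n (hardDist d α h₀ h₁) σ).expectedSubopt L =
      ∑ j, ENNReal.ofReal (α / 2) * (hardInstance n (hardDist d α h₀ h₁) σ).rewardLaw
        {r | L.toFun (hardDist d α h₀ h₁) (hardDesign d n) r (some j) ≠ σ j} := by
  have hmeas : ∀ j : Fin d, MeasurableSet
      {r | L.toFun (hardDist d α h₀ h₁) (hardDesign d n) r (some j) ≠ σ j} :=
    fun j => L.measurableSet_preimage _ _ {π | π (some j) ≠ σ j}
  have hpt : ∀ r, ENNReal.ofReal ((hardInstance n (hardDist d α h₀ h₁) σ).optValue -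
      (hardInstance n (hardDist d α h₀ h₁) σ).value
        (L.toFun (hardDist d α h₀ h₁) (hardDesign d n) r)) =
      ∑ j, Set.indicator {r | L.toFun (hardDist d α h₀ h₁) (hardDesign d n) r (some j) ≠ σ j}
        (fun _ => ENNReal.ofReal (α / 2)) r := by
    intro r
    rw [hardInstance_subopt, ENNReal.ofReal_sum_of_nonneg]
    · refine Finset.sum_congr rfl fun j _ => ?_
      simp only [Set.indicator_apply, Set.mem_ofPred_eq]
      split_ifs <;> simp
    · intro j _
      split_ifs <;> positivity
  calc (hardInstance n (hardDist d α h₀ h₁) σ).expectedSubopt L = _ := lintegral_congr hpt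
    _ = _ := by
      rw [lintegral_finsetSum _ fun j _ => measurable_const.indicator (hmeas j)]
      exact Finset.sum_congr rfl fun j _ => lintegral_indicator_const (hmeas j) _

/-- The constraint `hΛ` says that the mean feature vector, normalized by the sample covariance, has
`ℓ_q` norm at most `Λ` in the hard instances. Each of the `d` signs is missed with probability of
at least `1/6` on average over the cube, at a cost of `α / 2`. -/
theorem le_minimaxSubopt_feature {d n : ℕ} (hdn : d ≤ n) (hn : 0 < n) {α q Λ : ℝ} (hq : 0 < q)
    (h₀ : 0 ≤ α) (h₁ : d * α ≤ 1) (hΛ : (d : ℝ) ^ (1 / q) * (Real.sqrt n * α) ≤ Λ) :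
    ENNReal.ofReal (d * α / 12) ≤ minimaxSubopt (feature d) n q Λ := by
  refine le_iInf fun L => ?_
  set M : ℝ≥0∞ := ⨆ Q ∈ CB (feature d) n q Λ, Q.expectedSubopt L
  have hM : ∀ σ, (hardInstance n (hardDist d α h₀ h₁) σ).expectedSubopt L ≤ M := fun σ =>
    le_iSup₂_of_le _ (hardInstance_mem_CB hdn hn hq h₀ h₁ hΛ σ) le_rfl
  have key := card_mul_le_of_flip_le
    (fun σ => (hardInstance n (hardDist d α h₀ h₁) σ).rewardLaw) 3 (by norm_num)
    (fun σ j => rewardLaw_flip_le hdn _ σ j)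
    (fun r j => L.toFun (hardDist d α h₀ h₁) (hardDesign d n) r (some j))
    (ENNReal.ofReal (α / 2)) M
    (fun σ => (hardInstance_expectedSubopt h₀ h₁ σ L).symm.le.trans (hM σ))
  have h6 : (2 * 3 : ℝ≥0∞) = ENNReal.ofReal 6 := by
    rw [show (6 : ℝ) = 2 * 3 by norm_num, ENNReal.ofReal_mul (by norm_num)]
    simp
  rw [← ENNReal.mul_le_mul_iff_right (a := 2 * 3) (by simp) (by finiteness)]
  refine le_trans (le_of_eq ?_) key
  rw [h6, ← ENNReal.ofReal_mul (by norm_num), ← ENNReal.ofReal_natCast,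
    ← ENNReal.ofReal_mul (by positivity)]
  congr 1
  ring

end OfflineCB

end

theorem mainTheorem8 :
    ∃ c : ℝ, 0 < c ∧
      ∀ d : ℕ, 2 ≤ d →
        ∃ (S A : Type) (_ : Fintype S) (_ : Fintype A) (φ : S × A → Fin d → ℝ),
          ∀ (p q Λ : ℝ) (n : ℕ), 1 < q → q ≤ 2 → 1 / p + 1 / q = 1 →
            Real.sqrt 12 ≤ Λ → (d : ℝ) ^ (2 / q) * Λ ^ 2 ≤ (n : ℝ) →
              ENNReal.ofReal (c * (d : ℝ) ^ (1 / p) * Real.sqrt (1 / (n : ℝ)) * Λ)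
                ≤ OfflineCB.minimaxSubopt φ n q Λ := by
  refine ⟨1 / 12, by norm_num, fun d hd => ⟨Option (Fin d), Bool, inferInstance, inferInstance,
    OfflineCB.feature d, fun p q Λ n hq hq2 hpq hΛ hn => ?_⟩⟩
  have hd1 : (1 : ℝ) ≤ d := by exact_mod_cast (by omega : 1 ≤ d)
  have hd0 : (0 : ℝ) < d := by linarith
  have hq0 : 0 < q := by linarith
  have hΛ1 : 1 ≤ Λ := (Real.one_le_sqrt.2 (by norm_num)).trans hΛ
  have hΛ0 : 0 < Λ := by linarith
  have hqhalf : 1 / 2 ≤ 1 / q := one_div_le_one_div_of_le hq0 hq2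
  have hdn' : (d : ℝ) ≤ n := by
    refine le_trans ?_ hn
    have h₁ : (d : ℝ) ≤ (d : ℝ) ^ (2 / q) := by
      refine Real.self_le_rpow_of_one_le hd1 ?_
      rwa [le_div_iff₀ hq0, one_mul]
    nlinarith [one_le_pow₀ hΛ1 (n := 2)]
  have hdn : d ≤ n := by exact_mod_cast hdn'
  have hn0 : (0 : ℝ) < n := by linarith
  have hsn : 0 < Real.sqrt n := Real.sqrt_pos.2 hn0
  have hdq : 0 < (d : ℝ) ^ (1 / q) := Real.rpow_pos_of_pos hd0 _
  have hp : 1 / p = 1 - 1 / q := by linarith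
  have hdp : (d : ℝ) ^ (1 / p) = d / (d : ℝ) ^ (1 / q) := by
    rw [hp, Real.rpow_sub hd0, Real.rpow_one]
  have hsqrt : (d : ℝ) ^ (1 / q) * Λ ≤ Real.sqrt n := by
    refine Real.le_sqrt_of_sq_le (le_trans (le_of_eq ?_) hn)
    rw [mul_pow, ← Real.rpow_natCast, ← Real.rpow_mul hd0.le]
    congr 2
    push_cast
    ring
  -- The mass `α = Λ / (d ^ (1 / q) * √n)` makes the bound on the `ℓ_q` norm an equality.
  have hmass : d * (Λ / ((d : ℝ) ^ (1 / q) * Real.sqrt n)) ≤ 1 := by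
    -- This is `d ^ (1 / p) ≤ d ^ (1 / q)`, which needs `q ≤ 2`.
    have h₁ : (d : ℝ) / (d : ℝ) ^ (1 / q) ≤ (d : ℝ) ^ (1 / q) := by
      rw [← hdp, hp]
      exact Real.rpow_le_rpow_of_exponent_le hd1 (by linarith)
    calc d * (Λ / ((d : ℝ) ^ (1 / q) * Real.sqrt n))
        = (d / (d : ℝ) ^ (1 / q)) * Λ / Real.sqrt n := by field_simp
      _ ≤ (d : ℝ) ^ (1 / q) * Λ / Real.sqrt n := by gcongr
      _ ≤ 1 := (div_le_one hsn).2 hsqrt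
  refine le_trans (le_of_eq ?_) (OfflineCB.le_minimaxSubopt_feature hdn (by exact_mod_cast hn0)
    hq0 (by positivity) hmass (le_of_eq ?_))
  · congr 1
    rw [hdp, one_div (n : ℝ), Real.sqrt_inv]
    field_simp
  · field_simp
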